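/- Let $\mathcal G=(V,E)$ be a finite connected (undirected, simple) graph with $r=|V|\ge 2$ vertices; write $N(i)$ for the set of neighbours of $i$, $d_i=|N(i)|$, and $\Delta=\{x\in\mathbf R_{\ge 0}^V:\sum_{i\in V} x_i=1\}$. For $x\in\Delta$ and $a\in\mathbf N_0^V$ put $x^a=\prod_{i\in V}x_i^{a_i}$. Let $$Lf=\frac12\sum_{i,j\in V}\sigma_{ij}(x)\frac{\partial^2 f}{\partial x_i\partial x_j},\qquad \sigma_{ii}(x)=x_i\sum_{j\in N(i)}x_j,\quad \sigma_{ij}(x)=-x_ix_j\ (i\sim j),\quad \sigma_{ij}(x)=0\ \text{otherwise}.$$ Let $\{T_t\}_{t\ge0}$ be a strongly continuous Markov semigroup on $C(\Delta)$ (so $T_t1=1$, and $T_tf\ge0$ whenever $f\ge0$) associated with $L$, i.e. $T_tf-f=\int_0^tT_sLf\,ds$ for all $f\in C^2(\Delta)$ and $t\ge 0$. For $x\in\Delta$, let $(x(t),P_x)$ be a diffusion in $\Delta$ governed by $L$ and started from $x$, i.e. a process with continuous paths in $\Delta$ and $x(0)=x$ such that $f(x(t))-f(x(0))-\int_0^tLf(x(s))\,ds$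 is a martingale for every $f\in C^2(\Delta)$. Let $n\in\mathbf N_0$, $\Pi_{n,r}^{\ge0}=\{a\in\mathbf N_0^V:\sum_{i\in V} a_i=n\}$, and let $(a(t),\mathbf P_a)$, $a(0)=a$, be a continuous-time Markov chain on $\Pi_{n,r}^{\ge0}$ with right-continuous paths and rate matrix $$R_{a,a-e_i+e_j}=\frac{a_i(a_i-1)}2\ \ (i\in V,\ j\in N(i)),\qquad R_{a,b}=0\ \text{for all other } b\ne a,\qquad R_{a,a}=-\sum_{b\ne a}R_{a,b},$$ where $R_{a,b}=\lim_{t\downarrow0}(\mathbf P_a(a(t)=b)-\delta_{a,b})/t$. Then, for every $a\in\Pi_{n,r}^{\ge0}$, $x\in\Delta$ and $t\ge0$, the random variable in the expectation on the right-hand side below is integrable, and $$T_tx^a=\mathbf E_x\{(x(t))^a\}=\mathbf E_a\Big[x^{a(t)}\exp\Big\{-\int_0^tk(a(s))\,ds\Big\}\Big],$$ where the killing rate is $$k(a)=\sum_{i\in V}\sum_{j\in N(i)}\frac{a_ia_j}2-\sum_{i\in V}\frac{d_i\,a_i(a_i-1)}2.$$ -/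

import Mathlib

open MeasureTheory ProbabilityTheory Filter Topology Set
open scoped NNReal BigOperators

noncomputable section

namespace GraphDiffusion

/-! ### The diffusion side: simplex, generator, semigroup, diffusion process -/

/-- The first-order partial derivative `∂f/∂xᵢ` on `ℝ^V`. -/
def partialDeriv {V : Type*} [Fintype V] [DecidableEq V] (i : V) (f : (V → ℝ) → ℝ) :
    (V → ℝ) → ℝ :=
  fun x => fderiv ℝ f x (Pi.single i 1)

/-- The diffusion matrix: `σ i i = xᵢ ∑_{j ∈ N(i)} xⱼ`, `σ i j = - xᵢ xⱼ` for `i ∼ j`, and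
`σ i j = 0` otherwise. -/
def sigma {V : Type*} [Fintype V] [DecidableEq V] (G : SimpleGraph V) [DecidableRel G.Adj]
    (i j : V) (x : V → ℝ) : ℝ :=
  if i = j then x i * ∑ l ∈ G.neighborFinset i, x l
  else if G.Adj i j then -(x i * x j)
  else 0

/-- The generator `L f = ½ ∑_{i,j} σ i j ∂²f/∂xᵢ∂xⱼ`. -/
def generator {V : Type*} [Fintype V] [DecidableEq V] (G : SimpleGraph V) [DecidableRel G.Adj]
    (f : (V → ℝ) → ℝ) (x : V → ℝ) : ℝ :=
  (1 / 2) * ∑ i, ∑ j, sigma G i j x * partialDeriv i (partialDeriv j f) x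

theorem continuous_sigma {V : Type*} [Fintype V] [DecidableEq V] (G : SimpleGraph V)
    [DecidableRel G.Adj] (i j : V) : Continuous (sigma G i j) := by
  unfold sigma
  split_ifs <;> fun_prop

theorem contDiff_partialDeriv {V : Type*} [Fintype V] [DecidableEq V] (i : V)
    {f : (V → ℝ) → ℝ} {m : ℕ} (hf : ContDiff ℝ (m + 1) f) : ContDiff ℝ m (partialDeriv i f) := by
  unfold partialDeriv
  exact (hf.fderiv_right (m := (m : WithTop ℕ∞)) le_rfl).clm_apply contDiff_const

theorem continuous_generator {V : Type*} [Fintype V] [DecidableEq V] (G : SimpleGraph V)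
    [DecidableRel G.Adj] {f : (V → ℝ) → ℝ} (hf : ContDiff ℝ 2 f) :
    Continuous (generator G f) := by
  unfold generator
  refine continuous_const.mul (continuous_finsetSum _ fun i _ => continuous_finsetSum _
    fun j _ => (continuous_sigma G i j).mul ?_)
  have h1 : ContDiff ℝ ((1 : ℕ) : WithTop ℕ∞) (partialDeriv j f) :=
    contDiff_partialDeriv j (m := 1) (by norm_num; exact hf)
  have h0 : ContDiff ℝ ((0 : ℕ) : WithTop ℕ∞) (partialDeriv i (partialDeriv j f)) :=
    contDiff_partialDeriv i (m := 0) (by simpa using h1)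
  exact h0.continuous

/-- The restriction to the simplex of a `C²` function on `ℝ^V`. -/
def restrict {V : Type*} [Fintype V] (f : (V → ℝ) → ℝ) (hf : ContDiff ℝ 2 f) :
    C(stdSimplex ℝ V, ℝ) :=
  ⟨fun x => f x.1, hf.continuous.comp continuous_subtype_val⟩

/-- `L f` as a continuous function on the simplex, for a `C²` function `f`. -/
def generatorC {V : Type*} [Fintype V] [DecidableEq V] (G : SimpleGraph V) [DecidableRel G.Adj]
    (f : (V → ℝ) → ℝ) (hf : ContDiff ℝ 2 f) : C(stdSimplex ℝ V, ℝ) :=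
  ⟨fun x => generator G f x.1, (continuous_generator G hf).comp continuous_subtype_val⟩

/-- `T` is a strongly continuous Markov semigroup on `C(Δ)` associated with the generator `L`:
`T_t f - f = ∫₀ᵗ T_s (L f) ds` (an integral in the Banach space `C(Δ)`) for every `f` of class
`C²`. The simplex is compact, so compact support is no restriction. -/
structure IsMarkovSemigroup {V : Type*} [Fintype V] [DecidableEq V] (G : SimpleGraph V)
    [DecidableRel G.Adj]
    (T : ℝ≥0 → C(stdSimplex ℝ V, ℝ) →L[ℝ] C(stdSimplex ℝ V, ℝ)) : Prop where
  zero : ∀ f, T 0 f = f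
  add : ∀ s t f, T (s + t) f = T s (T t f)
  strongly_continuous : ∀ f, Continuous fun t => T t f
  map_one : ∀ t, T t 1 = 1
  nonneg : ∀ t f, 0 ≤ f → 0 ≤ T t f
  integral_eq : ∀ (f : (V → ℝ) → ℝ) (hf : ContDiff ℝ 2 f) (t : ℝ≥0),
    T t (restrict f hf) - restrict f hf = ∫ s in (0 : ℝ)..t, T s.toNNReal (generatorC G f hf)

/-- `X` is a diffusion on the simplex governed by the generator `L` and started from `x`:
a process with continuous paths that solves the martingale problem for `L`, that is,
`f(X_t) - f(X_0) - ∫₀ᵗ L f(X_s) ds` is a martingale for every `f` of class `C²`. -/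
structure IsDiffusion {V : Type*} [Fintype V] [DecidableEq V] (G : SimpleGraph V)
    [DecidableRel G.Adj] (x : stdSimplex ℝ V) {Ω : Type*} {mΩ : MeasurableSpace Ω}
    (ℱ : Filtration ℝ≥0 mΩ) (Px : Measure Ω) (X : ℝ≥0 → Ω → stdSimplex ℝ V) : Prop where
  isProbabilityMeasure : IsProbabilityMeasure Px
  adapted : ∀ t, Measurable[ℱ t] (X t)
  start : ∀ᵐ ω ∂Px, X 0 ω = x
  continuous_paths : ∀ᵐ ω ∂Px, Continuous fun t => X t ω
  martingale : ∀ f : (V → ℝ) → ℝ, ContDiff ℝ 2 f →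
    Martingale (fun (t : ℝ≥0) ω => f (X t ω).1 - f (X 0 ω).1
      - ∫ s in (0 : ℝ)..t, generator G f (X s.toNNReal ω).1) ℱ Px

/-! ### The dual side: the collision chain on ordered partitions -/

/-- The ordered non-negative integer partitions `a` of `n` indexed by `V`:
`a ∈ ℕ₀^V` with `∑ᵢ aᵢ = n`. -/
abbrev OrderedPartition (V : Type*) [Fintype V] (n : ℕ) : Type _ :=
  {a : V → ℕ // ∑ i, a i = n}

instance instFintypeOrderedPartition (V : Type*) [Fintype V] [DecidableEq V] (n : ℕ) :
    Fintype (OrderedPartition V n) :=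
  Fintype.subtype (Finset.piAntidiag Finset.univ n) (by intro a; simp)

/-- The monomial `x^a = ∏ᵢ xᵢ^{aᵢ}` as a continuous function on the simplex. -/
def monomial {V : Type*} [Fintype V] (a : V → ℕ) : C(stdSimplex ℝ V, ℝ) :=
  ⟨fun x => ∏ i, x.1 i ^ a i, continuous_finsetProd _ fun i _ =>
    ((continuous_apply i).comp continuous_subtype_val).pow _⟩

/-- The rate of the jump `a → b`, `b ≠ a`: it is `aᵢ(aᵢ-1)/2` if `b = a - eᵢ + eⱼ`, i.e.
`b + eᵢ = a + eⱼ`, for some `i` and some `j ∈ N(i)` (such a pair `(i, j)` is unique),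
and `0` otherwise. -/
def jumpRate {V : Type*} [Fintype V] [DecidableEq V] (G : SimpleGraph V) [DecidableRel G.Adj]
    (a b : V → ℕ) : ℝ :=
  ∑ i, ∑ j ∈ G.neighborFinset i,
    if b + Pi.single i 1 = a + Pi.single j 1 then (a i : ℝ) * ((a i : ℝ) - 1) / 2 else 0

/-- The rate matrix of the collision chain. -/
def rateMatrix {V : Type*} [Fintype V] [DecidableEq V] (G : SimpleGraph V) [DecidableRel G.Adj]
    (n : ℕ) (a b : OrderedPartition V n) : ℝ :=
  if a = b then -∑ c ∈ Finset.univ.erase a, jumpRate G a.1 c.1 else jumpRate G a.1 b.1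

/-- The killing rate `k(a) = ∑ᵢ ∑_{j ∈ N(i)} aᵢaⱼ/2 - ∑ᵢ dᵢaᵢ(aᵢ-1)/2`. -/
def killingRate {V : Type*} [Fintype V] [DecidableEq V] (G : SimpleGraph V) [DecidableRel G.Adj]
    (a : V → ℕ) : ℝ :=
  ∑ i, ∑ j ∈ G.neighborFinset i, (a i : ℝ) * (a j : ℝ) / 2
    - ∑ i, (G.degree i : ℝ) * (a i : ℝ) * ((a i : ℝ) - 1) / 2

/-- `(A t, P a)` is a time-homogeneous continuous-time Markov chain on `S` (a finite or countable
discrete state space) with rate matrix `R`: under `P a` it starts from `a`, has right-continuous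
paths and the Markov property with respect to its past, and
`R a b = lim_{t ↓ 0} (P a (A t = b) - δ_{a,b}) / t`. -/
structure IsMarkovChain {S : Type*} [DecidableEq S] [TopologicalSpace S] [MeasurableSpace S]
    (R : S → S → ℝ) {Ω : Type*} [MeasurableSpace Ω] (P : S → Measure Ω) (A : ℝ≥0 → Ω → S) :
    Prop where
  isProbabilityMeasure : ∀ a, IsProbabilityMeasure (P a)
  measurable : ∀ t, Measurable (A t)
  start : ∀ a, ∀ᵐ ω ∂(P a), A 0 ω = a
  right_continuous : ∀ a, ∀ᵐ ω ∂(P a), ∀ t, ContinuousWithinAt (fun s => A s ω) (Set.Ici t) t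
  markov : ∀ (a b : S) (s t : ℝ≥0) (E : Set Ω),
    MeasurableSet[⨆ u : Set.Iic s, MeasurableSpace.comap (A u) inferInstance] E →
      (P a).real (E ∩ {ω | A (s + t) ω = b})
        = ∫ ω in E, (P (A s ω)).real {ω' | A t ω' = b} ∂(P a)
  rates : ∀ a b : S,
    Tendsto (fun t : ℝ≥0 => ((P a).real {ω | A t ω = b} - if a = b then 1 else 0) / (t : ℝ))
      (𝓝[>] 0) (𝓝 (R a b))

/-- The Feynman–Kac functional `x^{a(t)} exp(-∫₀ᵗ k(a(s)) ds)` of the collision chain. -/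
def killedMonomial {V : Type*} [Fintype V] [DecidableEq V] (G : SimpleGraph V)
    [DecidableRel G.Adj] {n : ℕ} {Ω : Type*} (A : ℝ≥0 → Ω → OrderedPartition V n)
    (x : stdSimplex ℝ V) (t : ℝ≥0) (ω : Ω) : ℝ :=
  monomial (A t ω).1 x * Real.exp (-∫ s in (0 : ℝ)..t, killingRate G (A s.toNNReal ω).1)

end GraphDiffusion

end

noncomputable section

namespace GraphDiffusion

/-! ### The duality between the generator and the collision chain -/

/-! Fix $n$. The generator $L$ preserves the span of the monomials of degree $n$. In $Lx^a$ the
diagonal coefficients $\sigma_{ii}$ give $\frac{a_i(a_i-1)}2x^{a-e_i+e_j}$ for each $j\in N(i)$, and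
the off-diagonal ones give $-\frac{a_ia_j}2x^a$. Subtracting $x^a$ from each term of the first kind
turns them into the generator of the chain, and the multiple of $x^a$ left over is $-k(a)$. Hence
$Lx^a=\sum_bQ_{ab}x^b$ with $Q=R-\mathrm{diag}(k)$ a finite matrix (`generator_mon_eq_mulVec`).

All three quantities are then equal to the $a$-th entry of $e^{tQ}(x^b)_b$. The semigroup and the
diffusion moments both satisfy $y(t)-y(0)=\int_0^tQy(s)\,ds$, a linear equation with a unique
solution (`eq_exp_of_integral_eq`). For the chain this is the Feynman–Kac formula
(`IsMarkovChain.feynmanKac`): replacing the time integral by a Riemann sum of mesh $t/m$ gives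
exactly the $m$-th power of a one-step matrix by the Markov property, and these powers tend to
$e^{tQ}$. Finiteness of the state space bounds $k$, so its sign is irrelevant. -/

/-- The monomial `x^a` as a function on `ℝ^V`. -/
def mon {V : Type*} [Fintype V] (a : V → ℕ) (x : V → ℝ) : ℝ := ∏ i, x i ^ a i

theorem mon_add {V : Type*} [Fintype V] (a b : V → ℕ) (x : V → ℝ) :
    mon (a + b) x = mon a x * mon b x := by
  simp [mon, pow_add, Finset.prod_mul_distrib]

theorem mon_single {V : Type*} [Fintype V] [DecidableEq V] (i : V) (x : V → ℝ) :
    mon (Pi.single i 1) x = x i := by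
  rw [mon, Finset.prod_eq_single i] <;> simp +contextual

theorem contDiff_mon {V : Type*} [Fintype V] (a : V → ℕ) {m : WithTop ℕ∞} :
    ContDiff ℝ m (mon a) := by
  unfold mon
  fun_prop

theorem partialDeriv_const_mul {V : Type*} [Fintype V] [DecidableEq V] (i : V) (c : ℝ)
    {f : (V → ℝ) → ℝ} (hf : Differentiable ℝ f) :
    partialDeriv i (fun x => c * f x) = fun x => c * partialDeriv i f x := by
  funext x
  simp only [partialDeriv]
  rw [fderiv_const_mul (hf x)]
  simp

/-- The truncated subtraction is harmless: where it truncates, the coefficient $a_i$ is zero. -/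
theorem partialDeriv_mon {V : Type*} [Fintype V] [DecidableEq V] (i : V) (a : V → ℕ) :
    partialDeriv i (mon a) = fun x => (a i : ℝ) * mon (a - Pi.single i 1) x := by
  funext x
  have h : HasFDerivAt (mon a) (∑ j, (∏ l ∈ Finset.univ.erase j, x l ^ a l) •
      ((a j : ℝ) * x j ^ (a j - 1)) • ContinuousLinearMap.proj (R := ℝ) (φ := fun _ : V => ℝ) j) x := by
    refine HasFDerivAt.finsetProd fun j _ => ?_
    have := (hasDerivAt_pow (a j) (x j)).comp_hasFDerivAt x
      (ContinuousLinearMap.proj (R := ℝ) (φ := fun _ : V => ℝ) j).hasFDerivAt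
    exact this
  rw [partialDeriv, h.fderiv]
  simp only [_root_.sum_apply, _root_.smul_apply,
    ContinuousLinearMap.proj_apply, smul_eq_mul]
  rw [Finset.sum_eq_single i (fun j _ hj => by simp [hj]) (by simp), mon,
    ← Finset.mul_prod_erase _ _ (Finset.mem_univ i),
    Finset.prod_congr rfl (g := fun l => x l ^ (a - Pi.single i 1 : V → ℕ) l)]
  · simp; ring
  · intro l hl
    simp [(Finset.mem_erase.1 hl).1]

theorem partialDeriv_partialDeriv_mon {V : Type*} [Fintype V] [DecidableEq V] (i j : V)
    (a : V → ℕ) (x : V → ℝ) :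
    partialDeriv i (partialDeriv j (mon a)) x
      = (a j : ℝ) * (((a - Pi.single j 1 : V → ℕ) i : ℕ) * mon (a - Pi.single j 1 - Pi.single i 1) x) := by
  rw [partialDeriv_mon, partialDeriv_const_mul _ _ ((contDiff_mon _).differentiable one_ne_zero),
    partialDeriv_mon]

theorem mul_mul_partialDeriv_mon_of_ne {V : Type*} [Fintype V] [DecidableEq V] {i j : V}
    (hij : i ≠ j) (a : V → ℕ) (x : V → ℝ) :
    x i * x j * partialDeriv i (partialDeriv j (mon a)) x = (a i : ℝ) * a j * mon a x := by
  rw [partialDeriv_partialDeriv_mon]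
  have h0 : (a - Pi.single j 1 : V → ℕ) i = a i := by simp [hij]
  rw [h0]
  rcases Nat.eq_zero_or_pos (a i) with hi | hi
  · simp [hi]
  rcases Nat.eq_zero_or_pos (a j) with hj | hj
  · simp [hj]
  have h : a = a - Pi.single j 1 - Pi.single i 1 + Pi.single i 1 + Pi.single j 1 := by
    funext l
    by_cases hl : l = i
    · subst hl; simp [hij]; omega
    · by_cases hl' : l = j
      · subst hl'; simp [hl]; omega
      · simp [hl, hl']
  conv_rhs => rw [h]
  rw [mon_add, mon_add, mon_single, mon_single, ← h]
  ring

/-- Only one of the two lost factors $x_i$ is restored, because $\sigma_{ii}$ carries a single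
$x_i$; its other factor $x_j$ then produces the jump $a\to a-e_i+e_j$. -/
theorem mul_partialDeriv_self_mon {V : Type*} [Fintype V] [DecidableEq V] (i : V)
    (a : V → ℕ) (x : V → ℝ) :
    x i * partialDeriv i (partialDeriv i (mon a)) x
      = (a i : ℝ) * (a i - 1) * mon (a - Pi.single i 1) x := by
  rw [partialDeriv_partialDeriv_mon]
  rcases Nat.lt_or_ge (a i) 2 with hi | hi
  · interval_cases h : a i <;> simp [h]
  have h : a - Pi.single i 1 = a - Pi.single i 1 - Pi.single i 1 + Pi.single i 1 := by
    funext l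
    by_cases hl : l = i
    · subst hl; simp; omega
    · simp [hl]
  have h1 : (((a - Pi.single i 1 : V → ℕ) i : ℕ) : ℝ) = (a i : ℝ) - 1 := by
    simp [Nat.cast_sub (show 1 ≤ a i by omega)]
  conv_rhs => rw [h]
  rw [mon_add, mon_single, h1]
  ring

theorem generator_mon {V : Type*} [Fintype V] [DecidableEq V] (G : SimpleGraph V)
    [DecidableRel G.Adj] (a : V → ℕ) (x : V → ℝ) :
    generator G (mon a) x = ∑ i, ∑ j ∈ G.neighborFinset i,
      ((a i : ℝ) * (a i - 1) / 2 * mon (a - Pi.single i 1 + Pi.single j 1) x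
        - (a i : ℝ) * a j / 2 * mon a x) := by
  rw [generator, Finset.mul_sum]
  refine Finset.sum_congr rfl fun i _ => ?_
  rw [← Finset.add_sum_erase _ _ (Finset.mem_univ i)]
  have h1 : sigma G i i x * partialDeriv i (partialDeriv i (mon a)) x
      = ∑ j ∈ G.neighborFinset i,
        (a i : ℝ) * (a i - 1) * mon (a - Pi.single i 1 + Pi.single j 1) x := by
    rw [sigma, if_pos rfl, mul_right_comm, mul_partialDeriv_self_mon, Finset.mul_sum]
    exact Finset.sum_congr rfl fun j _ => by rw [mon_add, mon_single]; ring
  have h2 : ∑ j ∈ Finset.univ.erase i, sigma G i j x * partialDeriv i (partialDeriv j (mon a)) x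
      = ∑ j ∈ G.neighborFinset i, -((a i : ℝ) * a j * mon a x) := by
    symm
    refine Finset.sum_subset_zero_on_sdiff (fun j hj => ?_) (fun j hj => ?_) (fun j hj => ?_)
    · rw [SimpleGraph.mem_neighborFinset] at hj
      simpa using hj.ne'
    · simp only [Finset.mem_sdiff, Finset.mem_erase, SimpleGraph.mem_neighborFinset] at hj
      simp [sigma, hj.1.1.symm, hj.2]
    · rw [SimpleGraph.mem_neighborFinset] at hj
      rw [sigma, if_neg hj.ne, if_pos hj, ← mul_mul_partialDeriv_mon_of_ne hj.ne]
      ring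
  rw [h1, h2, ← Finset.sum_add_distrib, Finset.mul_sum]
  exact Finset.sum_congr rfl fun j _ => by ring

/-- The rate matrix of the collision chain, killed at rate `k`. -/
def killedRate {V : Type*} [Fintype V] [DecidableEq V] (G : SimpleGraph V) [DecidableRel G.Adj]
    (n : ℕ) : Matrix (OrderedPartition V n) (OrderedPartition V n) ℝ :=
  Matrix.of (rateMatrix G n) - Matrix.diagonal fun a => killingRate G a.1

theorem jumpRate_self {V : Type*} [Fintype V] [DecidableEq V] (G : SimpleGraph V)
    [DecidableRel G.Adj] (a : V → ℕ) : jumpRate G a a = 0 := by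
  refine Finset.sum_eq_zero fun i _ => Finset.sum_eq_zero fun j hj => if_neg fun h => ?_
  rw [SimpleGraph.mem_neighborFinset] at hj
  have := congrFun (add_left_cancel h) i
  simp [hj.ne] at this

/-- The rows of the rate matrix sum to zero, so it acts through differences. -/
theorem sum_rateMatrix_mul {V : Type*} [Fintype V] [DecidableEq V] (G : SimpleGraph V)
    [DecidableRel G.Adj] {n : ℕ} (a : OrderedPartition V n) (f : OrderedPartition V n → ℝ) :
    ∑ b, rateMatrix G n a b * f b = ∑ b, jumpRate G a.1 b.1 * (f b - f a) := by
  rw [← Finset.add_sum_erase _ (fun b => rateMatrix G n a b * f b) (Finset.mem_univ a),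
    ← Finset.add_sum_erase _ (fun b => jumpRate G a.1 b.1 * (f b - f a))
      (Finset.mem_univ a), jumpRate_self,
    Finset.sum_congr rfl (g := fun b => jumpRate G a.1 b.1 * f b) fun b hb => by
      rw [rateMatrix, if_neg (Finset.mem_erase.1 hb).1.symm], rateMatrix, if_pos rfl]
  simp only [mul_sub, Finset.sum_sub_distrib, ← Finset.sum_mul]
  ring

/-- If $a_i\ge1$, each pair $(i,j)$ has exactly one target, again of total mass $n$. If $a_i=0$ the
rate vanishes, so the truncated target does not matter. -/
theorem sum_jumpRate_mul {V : Type*} [Fintype V] [DecidableEq V] (G : SimpleGraph V)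
    [DecidableRel G.Adj] {n : ℕ} (a : OrderedPartition V n) (f : (V → ℕ) → ℝ) :
    ∑ b : OrderedPartition V n, jumpRate G a.1 b.1 * f b.1
      = ∑ i, ∑ j ∈ G.neighborFinset i,
        (a.1 i : ℝ) * (a.1 i - 1) / 2 * f (a.1 - Pi.single i 1 + Pi.single j 1) := by
  simp only [jumpRate, Finset.sum_mul]
  rw [Finset.sum_comm]
  refine Finset.sum_congr rfl fun i _ => ?_
  rw [Finset.sum_comm]
  refine Finset.sum_congr rfl fun j hj => ?_
  rcases Nat.eq_zero_or_pos (a.1 i) with hi | hi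
  · simp [hi]
  have hle : Pi.single i 1 ≤ a.1 := by
    intro l
    by_cases hl : l = i
    · subst hl; simpa using Nat.one_le_iff_ne_zero.2 hi.ne'
    · simp [hl]
  have hsum : ∑ l, (a.1 - Pi.single i 1 + Pi.single j 1 : V → ℕ) l = n := by
    have h1 : ∑ l, (a.1 - Pi.single i 1 + Pi.single j 1 + Pi.single i 1 : V → ℕ) l
        = ∑ l, (a.1 + Pi.single j 1 : V → ℕ) l := by
      rw [add_right_comm, tsub_add_cancel_of_le hle]
    simp only [Pi.add_apply, Finset.sum_add_distrib, Finset.sum_pi_single', Finset.mem_univ,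
      if_true, a.2] at h1 ⊢
    omega
  rw [Finset.sum_eq_single ⟨_, hsum⟩]
  · rw [if_pos]
    rw [add_right_comm, tsub_add_cancel_of_le hle]
  · intro b _ hb
    rw [if_neg, zero_mul]
    intro h
    refine hb (Subtype.ext (add_right_cancel (b := Pi.single i 1) ?_))
    rw [h, add_right_comm, tsub_add_cancel_of_le hle]
  · simp

/-- Duality: `L x^a = ∑_b (R_{a,b} - k(a) δ_{a,b}) x^b`. -/
theorem generator_mon_eq_mulVec {V : Type*} [Fintype V] [DecidableEq V] (G : SimpleGraph V)
    [DecidableRel G.Adj] {n : ℕ} (a : OrderedPartition V n) (x : V → ℝ) :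
    generator G (mon a.1) x = (killedRate G n).mulVec (fun b => mon b.1 x) a := by
  have h := sum_rateMatrix_mul G a (fun b => mon b.1 x)
  rw [sum_jumpRate_mul G a (fun b => mon b x - mon a.1 x)] at h
  rw [killedRate, Matrix.sub_mulVec, Pi.sub_apply, Matrix.mulVec_diagonal]
  change _ = ∑ b, rateMatrix G n a b * mon b.1 x - _
  rw [h, generator_mon, killingRate, sub_mul, Finset.sum_mul, Finset.sum_mul,
    ← Finset.sum_sub_distrib, ← Finset.sum_sub_distrib]
  refine Finset.sum_congr rfl fun i _ => ?_
  simp only [mul_sub, Finset.sum_sub_distrib, Finset.sum_mul, Finset.sum_const,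
    SimpleGraph.card_neighborFinset_eq_degree, nsmul_eq_mul]
  ring

/-! ### Exponentials in Banach algebras and linear differential equations -/

/-- Telescoping, one factor at a time. The exponent $m$ in place of $m-1$ is affordable since
$K\ge1$. -/
theorem norm_pow_sub_pow_le {𝔸 : Type*} [NormedRing 𝔸] [NormOneClass 𝔸] {x y : 𝔸} {K : ℝ}
    (hK : 1 ≤ K) (hx : ‖x‖ ≤ K) (hy : ‖y‖ ≤ K) (m : ℕ) :
    ‖x ^ m - y ^ m‖ ≤ m * ‖x - y‖ * K ^ m := by
  have hK0 : 0 ≤ K := zero_le_one.trans hK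
  induction m with
  | zero => simp
  | succ m ih =>
    have h1 : x ^ (m + 1) - y ^ (m + 1) = x * (x ^ m - y ^ m) + (x - y) * y ^ m := by
      rw [pow_succ', pow_succ']; noncomm_ring
    have h2 : ‖y ^ m‖ ≤ K ^ m := (norm_pow_le y m).trans (pow_le_pow_left₀ (norm_nonneg _) hy m)
    have h3 : K ^ m ≤ K ^ (m + 1) := pow_le_pow_right₀ hK m.le_succ
    calc ‖x ^ (m + 1) - y ^ (m + 1)‖
        ≤ ‖x‖ * ‖x ^ m - y ^ m‖ + ‖x - y‖ * ‖y ^ m‖ := by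
          rw [h1]
          exact (norm_add_le _ _).trans (add_le_add (norm_mul_le _ _) (norm_mul_le _ _))
      _ ≤ K * (m * ‖x - y‖ * K ^ m) + ‖x - y‖ * K ^ (m + 1) := by
          gcongr
          exact h2.trans h3
      _ = (m + 1 : ℕ) * ‖x - y‖ * K ^ (m + 1) := by push_cast; ring

/-- If `m (Mₘ - 1) → B` and `m (Nₘ - 1) → B`, then `Mₘ ^ m - Nₘ ^ m → 0`. -/
theorem tendsto_pow_sub_pow {𝔸 : Type*} [NormedRing 𝔸] [NormOneClass 𝔸] [NormedAlgebra ℝ 𝔸]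
    {M N : ℕ → 𝔸} {B : 𝔸} (hM : Tendsto (fun m : ℕ => (m : ℝ) • (M m - 1)) atTop (𝓝 B))
    (hN : Tendsto (fun m : ℕ => (m : ℝ) • (N m - 1)) atTop (𝓝 B)) :
    Tendsto (fun m => M m ^ m - N m ^ m) atTop (𝓝 0) := by
  -- With $c=\|B\|+1$, the norms are at most $1+c/m$, so their $m$-th powers stay below $e^c$, while
  -- $m\|M_m-N_m\|\to0$.
  have hbd : ∀ {L : ℕ → 𝔸}, Tendsto (fun m : ℕ => (m : ℝ) • (L m - 1)) atTop (𝓝 B) →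
      ∀ᶠ m : ℕ in atTop, ‖L m‖ ≤ 1 + (‖B‖ + 1) / m := by
    intro L hL
    filter_upwards [hL.norm.eventually (gt_mem_nhds (lt_add_one ‖B‖)), eventually_gt_atTop 0]
      with m hm hm0
    have hm0' : (0 : ℝ) < m := Nat.cast_pos.2 hm0
    rw [norm_smul, Real.norm_natCast] at hm
    have h1 : ‖L m - 1‖ ≤ (‖B‖ + 1) / m := by
      rw [le_div_iff₀ hm0', mul_comm]; exact hm.le
    calc ‖L m‖ = ‖1 + (L m - 1)‖ := by rw [add_sub_cancel]
      _ ≤ ‖(1 : 𝔸)‖ + ‖L m - 1‖ := norm_add_le _ _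
      _ ≤ 1 + (‖B‖ + 1) / m := by rw [norm_one]; gcongr
  have hdiff : Tendsto (fun m : ℕ => ‖(m : ℝ) • (M m - 1) - (m : ℝ) • (N m - 1)‖
      * Real.exp (‖B‖ + 1)) atTop (𝓝 0) := by
    have := ((hM.sub hN).norm).mul_const (Real.exp (‖B‖ + 1))
    simpa using this
  refine squeeze_zero_norm' ?_ hdiff
  filter_upwards [hbd hM, hbd hN, eventually_gt_atTop 0] with m h1 h2 hm0
  have hm0' : (0 : ℝ) < m := Nat.cast_pos.2 hm0
  refine (norm_pow_sub_pow_le (le_add_of_nonneg_right (by positivity)) h1 h2 m).trans ?_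
  rw [← smul_sub, sub_sub_sub_cancel_right, norm_smul, Real.norm_natCast]
  gcongr
  calc (1 + (‖B‖ + 1) / m) ^ m ≤ Real.exp ((‖B‖ + 1) / m) ^ m := by
        gcongr
        rw [add_comm]
        exact Real.add_one_le_exp _
    _ = Real.exp (‖B‖ + 1) := by
        rw [← Real.exp_nat_mul, mul_div_cancel₀ _ hm0'.ne']

/-- Comparison with $N_m=e^{B/m}$, whose $m$-th power is exactly $e^B$; the derivative of the
exponential at $0$ gives $m(N_m-1)\to B$. -/
theorem tendsto_pow_exp_of_tendsto {𝔸 : Type*} [NormedRing 𝔸] [NormOneClass 𝔸]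
    [NormedAlgebra ℝ 𝔸] [CompleteSpace 𝔸] {M : ℕ → 𝔸} {B : 𝔸}
    (hM : Tendsto (fun m : ℕ => (m : ℝ) • (M m - 1)) atTop (𝓝 B)) :
    Tendsto (fun m => M m ^ m) atTop (𝓝 (NormedSpace.exp B)) := by
  let : NormedAlgebra ℚ 𝔸 := NormedAlgebra.restrictScalars ℚ ℝ 𝔸
  have hN : Tendsto (fun m : ℕ => (m : ℝ) • (NormedSpace.exp ((m : ℝ)⁻¹ • B) - 1)) atTop
      (𝓝 B) := by
    have h := (hasDerivAt_exp_smul_const (𝕂 := ℝ) B 0).tendsto_slope_zero_right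
    simp only [zero_add, zero_smul, NormedSpace.exp_zero, one_mul] at h
    have hinv : Tendsto (fun m : ℕ => (m : ℝ)⁻¹) atTop (𝓝[>] 0) :=
      tendsto_inv_atTop_nhdsGT_zero.comp tendsto_natCast_atTop_atTop
    simpa [Function.comp_def] using h.comp hinv
  have h := (tendsto_pow_sub_pow hM hN).add_const (NormedSpace.exp B)
  rw [zero_add] at h
  refine h.congr' ?_
  filter_upwards [eventually_gt_atTop 0] with m hm
  have : NormedSpace.exp ((m : ℝ)⁻¹ • B) ^ m = NormedSpace.exp B := by
    rw [← NormedSpace.exp_nsmul, ← Nat.cast_smul_eq_nsmul ℝ, smul_smul,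
      mul_inv_cancel₀ (Nat.cast_ne_zero.2 hm.ne'), one_smul]
  rw [this, sub_add_cancel]

/-- A square matrix as a bounded operator on `ℝ^S`. -/
def matrixCLM {S : Type*} [Fintype S] [DecidableEq S] :
    Matrix S S ℝ →ₗ[ℝ] ((S → ℝ) →L[ℝ] (S → ℝ)) :=
  LinearMap.toContinuousLinearMap.toLinearMap ∘ₗ (Matrix.toLin' : Matrix S S ℝ ≃ₗ[ℝ] _).toLinearMap

@[simp]
theorem matrixCLM_apply {S : Type*} [Fintype S] [DecidableEq S] (Q : Matrix S S ℝ) (v : S → ℝ) :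
    matrixCLM Q v = Q.mulVec v := rfl

theorem matrixCLM_one {S : Type*} [Fintype S] [DecidableEq S] :
    matrixCLM (1 : Matrix S S ℝ) = 1 := by
  ext1 v
  simp

theorem matrixCLM_pow_apply {S : Type*} [Fintype S] [DecidableEq S] (Q : Matrix S S ℝ) (m : ℕ)
    (v : S → ℝ) : (matrixCLM Q ^ m) v = (Q ^ m).mulVec v := by
  induction m generalizing v with
  | zero => simp
  | succ m ih => rw [pow_succ, pow_succ, mul_apply_eq_comp, ih, ← Matrix.mulVec_mulVec,
      matrixCLM_apply]

theorem continuous_matrixCLM {S : Type*} [Fintype S] [DecidableEq S] :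
    Continuous (matrixCLM : Matrix S S ℝ →ₗ[ℝ] _) :=
  LinearMap.continuous_of_finiteDimensional _

theorem eq_exp_of_integral_eq {S : Type*} [Fintype S] [DecidableEq S] (Q : Matrix S S ℝ)
    {y : ℝ → S → ℝ} (hy : Continuous y) (y₀ : S → ℝ)
    (h : ∀ t, 0 ≤ t → ∀ a, y t a - y₀ a = ∫ s in (0 : ℝ)..t, Q.mulVec (y s) a)
    {t : ℝ} (ht : 0 ≤ t) :
    y t = NormedSpace.exp (t • matrixCLM Q) y₀ := by
  have hQ : Continuous fun s => Q.mulVec (y s) := (matrixCLM Q).continuous.comp hy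
  have hy0 : y 0 = y₀ := funext fun a => by
    have := h 0 le_rfl a
    rwa [intervalIntegral.integral_same, sub_eq_zero] at this
  -- The equation for `y` holds only for $t\ge0$, but its right-hand side is differentiable on the
  -- whole line and agrees with `y` there; this gives the right derivatives needed for ODE
  -- uniqueness.
  have hz : ∀ s, HasDerivAt (fun t a => y₀ a + ∫ s in (0 : ℝ)..t, Q.mulVec (y s) a)
      (matrixCLM Q (y s)) s := fun s => hasDerivAt_pi.2 fun a => by
    have hc : Continuous fun s => Q.mulVec (y s) a := (continuous_apply a).comp hQ
    exact (intervalIntegral.integral_hasDerivAt_right (hc.intervalIntegrable _ _)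
      (hc.stronglyMeasurableAtFilter _ _) hc.continuousAt).const_add _
  have hyz : ∀ s, 0 ≤ s → y s = fun a => y₀ a + ∫ r in (0 : ℝ)..s, Q.mulVec (y r) a :=
    fun s hs => funext fun a => by rw [← h s hs a]; ring
  have he : ∀ s : ℝ, HasDerivAt (fun t : ℝ => NormedSpace.exp (t • matrixCLM Q) y₀)
      (matrixCLM Q (NormedSpace.exp (s • matrixCLM Q) y₀)) s := fun s =>
    (ContinuousLinearMap.apply ℝ (S → ℝ) y₀).hasFDerivAt.comp_hasDerivAt s
      (hasDerivAt_exp_smul_const' (matrixCLM Q) s)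
  refine ODE_solution_unique (v := fun _ => matrixCLM Q) (a := 0) (b := t)
    (fun _ => (matrixCLM Q).lipschitz) hy.continuousOn (fun s hs => ?_)
    (fun s _ => (he s).continuousAt.continuousWithinAt)
    (fun s _ => (he s).hasDerivWithinAt) ?_ ⟨ht, le_rfl⟩
  · exact (hz s).hasDerivWithinAt.congr (fun r hr => hyz r (hs.1.trans hr)) (hyz s hs.1)
  · simp [hy0]

/-! ### Riemann sums at right endpoints -/

/-- The sum is the integral of the step function $g(\lceil sm\rceil/m)$. Since $\lceil sm\rceil/m$
tends to $s$ from the right, right-continuity and dominated convergence suffice, and `g` need not be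
assumed measurable. -/
theorem tendsto_sum_right_endpoints {g : ℝ → ℝ} (hg : ∀ s, ContinuousWithinAt g (Ici s) s)
    {C : ℝ} (hC : ∀ s, |g s| ≤ C) :
    Tendsto (fun m : ℕ => (m : ℝ)⁻¹ * ∑ i ∈ Finset.range m, g ((i + 1 : ℕ) / m)) atTop
      (𝓝 (∫ s in (0 : ℝ)..1, g s)) := by
  have hmeas : ∀ m : ℕ, Measurable fun s : ℝ => g (⌈s * m⌉₊ / m) := fun m =>
    (measurable_from_top (f := fun l : ℕ => g (l / m))).comp
      (Nat.measurable_ceil.comp (measurable_id.mul_const _))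
  have hint : ∀ (m : ℕ) (a b : ℝ), IntervalIntegrable (fun s : ℝ => g (⌈s * m⌉₊ / m)) volume a b :=
    fun m a b => (intervalIntegrable_const (c := C)).mono_fun
      (hmeas m).aestronglyMeasurable (Eventually.of_forall fun s => by
        simpa using (hC _).trans (le_abs_self C))
  have hlim : Tendsto (fun m : ℕ => ∫ s in (0 : ℝ)..1, g (⌈s * m⌉₊ / m)) atTop
      (𝓝 (∫ s in (0 : ℝ)..1, g s)) := by
    refine intervalIntegral.tendsto_integral_filter_of_dominated_convergence (fun _ => C)
      (Eventually.of_forall fun m => (hmeas m).aestronglyMeasurable)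
      (Eventually.of_forall fun m => Eventually.of_forall fun s _ => hC _)
      intervalIntegrable_const (Eventually.of_forall fun s hs => ?_)
    rw [uIoc_of_le zero_le_one] at hs
    refine (hg s).tendsto.comp (tendsto_nhdsWithin_iff.2
      ⟨(tendsto_nat_ceil_mul_div_atTop hs.1.le).comp tendsto_natCast_atTop_atTop, ?_⟩)
    filter_upwards [eventually_gt_atTop 0] with m hm
    rw [mem_Ici, le_div_iff₀ (Nat.cast_pos.2 hm)]
    exact Nat.le_ceil _
  refine hlim.congr' ?_
  filter_upwards [eventually_gt_atTop 0] with m hm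
  have hm0 : (0 : ℝ) < m := Nat.cast_pos.2 hm
  have hsum := intervalIntegral.sum_integral_adjacent_intervals (n := m) (μ := volume)
    (a := fun i : ℕ => (i : ℝ) / m) (f := fun s : ℝ => g (⌈s * m⌉₊ / m)) fun i _ => hint m _ _
  simp only [Nat.cast_zero, zero_div, div_self hm0.ne'] at hsum
  rw [← hsum, Finset.mul_sum]
  refine Finset.sum_congr rfl fun i _ => ?_
  have hle : (i : ℝ) / m ≤ (i + 1 : ℕ) / m := by gcongr; simp
  rw [intervalIntegral.integral_congr_ae (g := fun _ => g ((i + 1 : ℕ) / m))]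
  · rw [intervalIntegral.integral_const, ← sub_div, smul_eq_mul]
    push_cast
    rw [add_sub_cancel_left, one_div]
  · refine Eventually.of_forall fun s hs => ?_
    rw [uIoc_of_le hle, mem_Ioc, div_lt_iff₀ hm0, le_div_iff₀ hm0] at hs
    have : ⌈s * m⌉₊ = i + 1 := by
      rw [Nat.ceil_eq_iff (Nat.succ_ne_zero _)]
      exact ⟨by simpa using hs.1, hs.2⟩
    simp only [this]

/-! ### The Feynman–Kac formula for a finite Markov chain -/

/-- The transition matrix at time `t` of the chain `(A t, P a)`. -/
def transition {S Ω : Type*} [MeasurableSpace Ω] (P : S → Measure Ω) (A : ℝ≥0 → Ω → S)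
    (t : ℝ≥0) : Matrix S S ℝ :=
  Matrix.of fun a b => (P a).real {ω | A t ω = b}

/-- The past at time `s` of the process `A`. -/
abbrev past {S Ω : Type*} [MeasurableSpace S] (A : ℝ≥0 → Ω → S) (s : ℝ≥0) :
    MeasurableSpace Ω :=
  ⨆ u : Set.Iic s, MeasurableSpace.comap (A u) inferInstance

theorem measurable_past {S Ω : Type*} [MeasurableSpace S] (A : ℝ≥0 → Ω → S) {u s : ℝ≥0}
    (hus : u ≤ s) : Measurable[past A s] (A u) :=
  Measurable.of_comap_le (le_iSup (fun u : Set.Iic s =>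
    MeasurableSpace.comap (A u) inferInstance) ⟨u, hus⟩)

theorem IsMarkovChain.past_le {S : Type*} [DecidableEq S] [TopologicalSpace S]
    [MeasurableSpace S] {R : S → S → ℝ} {Ω : Type*} [MeasurableSpace Ω] {P : S → Measure Ω}
    {A : ℝ≥0 → Ω → S} (hA : IsMarkovChain R P A) (s : ℝ≥0) :
    past A s ≤ (inferInstance : MeasurableSpace Ω) :=
  iSup_le fun u => (hA.measurable u).comap_le

theorem exists_bound {S : Type*} [Fintype S] (f : S → ℝ) : ∃ C, 0 ≤ C ∧ ∀ b, |f b| ≤ C :=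
  ⟨∑ b, |f b|, Finset.sum_nonneg fun _ _ => abs_nonneg _,
    fun b => Finset.single_le_sum (f := fun b => |f b|) (fun _ _ => abs_nonneg _)
      (Finset.mem_univ b)⟩

theorem integrable_of_bound {Ω : Type*} [MeasurableSpace Ω] {μ : Measure Ω} [IsFiniteMeasure μ]
    {f : Ω → ℝ} (hf : AEStronglyMeasurable f μ) {C : ℝ} (hC : ∀ ω, |f ω| ≤ C) : Integrable f μ :=
  Integrable.of_bound hf C (Eventually.of_forall hC)

/-- Product rule at $h=0$, with $D_h$ the diagonal factor and $P_h$ the transition matrix: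
$(P_hD_h-1)/h=\frac{P_h-1}hD_h+\frac{D_h-1}h$, taken entrywise. -/
theorem IsMarkovChain.tendsto_transition {S : Type*} [Fintype S] [DecidableEq S]
    [TopologicalSpace S] [MeasurableSpace S] {R : S → S → ℝ} {Ω : Type*} [MeasurableSpace Ω]
    {P : S → Measure Ω} {A : ℝ≥0 → Ω → S} (hA : IsMarkovChain R P A) (k : S → ℝ) :
    Tendsto (fun h : ℝ≥0 => (h : ℝ)⁻¹ •
        (transition P A h * Matrix.diagonal (fun b => Real.exp (-(h * k b))) - 1))
      (𝓝[>] 0) (𝓝 (Matrix.of R - Matrix.diagonal k)) := by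
  have hcoe : Tendsto (fun h : ℝ≥0 => (h : ℝ)) (𝓝[>] 0) (𝓝[>] 0) :=
    tendsto_nhdsWithin_iff.2 ⟨(NNReal.continuous_coe.tendsto' 0 0 rfl).mono_left inf_le_left,
      eventually_mem_nhdsWithin.mono fun h hh => NNReal.coe_pos.2 hh⟩
  refine tendsto_pi_nhds.2 fun a => tendsto_pi_nhds.2 fun b => ?_
  have hexp : HasDerivAt (fun u : ℝ => Real.exp (-(u * k b))) (-k b) 0 := by
    simpa using (((hasDerivAt_id (0 : ℝ)).mul_const (k b)).neg).exp
  have h1 : Tendsto (fun h : ℝ≥0 => Real.exp (-(h * k b))) (𝓝[>] 0) (𝓝 1) := by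
    have := (hexp.continuousAt.tendsto.mono_left inf_le_left).comp hcoe
    simpa [Function.comp_def] using this
  have h2 : Tendsto (fun h : ℝ≥0 => (h : ℝ)⁻¹ * (Real.exp (-(h * k b)) - 1)) (𝓝[>] 0)
      (𝓝 (-k b)) := by
    simpa [Function.comp_def] using hexp.tendsto_slope_zero_right.comp hcoe
  have h3 := ((hA.rates a b).mul h1).add (h2.const_mul (if a = b then 1 else 0))
  convert h3 using 1
  · funext h
    simp only [Matrix.smul_apply, Matrix.sub_apply, Matrix.mul_diagonal, Matrix.one_apply,
      transition, Matrix.of_apply, smul_eq_mul]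
    ring
  · congr 1
    by_cases hab : a = b
    · subst hab; simp [sub_eq_add_neg]
    · simp [hab]

theorem tendsto_riemann_chain {S : Type*} [Fintype S] [TopologicalSpace S]
    [DiscreteTopology S] {α : ℝ≥0 → S}
    (hα : ∀ t, ContinuousWithinAt α (Set.Ici t) t) (k : S → ℝ) (t : ℝ≥0) :
    Tendsto (fun m : ℕ => ∑ i ∈ Finset.range m, (t / m : ℝ≥0) * k (α ((i + 1 : ℕ) * (t / m))))
      atTop (𝓝 (∫ s in (0 : ℝ)..t, k (α s.toNNReal))) := by
  obtain ⟨K, -, hK⟩ := exists_bound k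
  have hg : ∀ s : ℝ, ContinuousWithinAt (fun s : ℝ => k (α (t * s).toNNReal)) (Set.Ici s) s := by
    intro s
    refine (continuous_of_discreteTopology (f := k)).continuousAt.comp_continuousWithinAt ?_
    refine (hα _).comp (f := fun s : ℝ => (t * s).toNNReal)
      (by fun_prop) fun r hr => ?_
    exact Real.toNNReal_mono (mul_le_mul_of_nonneg_left hr t.2)
  have h := (tendsto_sum_right_endpoints hg fun s => hK _).const_mul (t : ℝ)
  rw [intervalIntegral.mul_integral_comp_mul_left (f := fun s => k (α s.toNNReal)), mul_zero,
    mul_one] at h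
  refine h.congr fun m => ?_
  rw [Finset.mul_sum, Finset.mul_sum]
  refine Finset.sum_congr rfl fun i _ => ?_
  have : ((t : ℝ) * ((i + 1 : ℕ) / m)).toNNReal = (i + 1 : ℕ) * (t / m) := by
    rw [← Real.toNNReal_coe (r := (i + 1 : ℕ) * (t / m))]
    congr 1
    push_cast
    ring
  rw [this]
  push_cast
  ring

section Chain

variable {S : Type*} [Fintype S] [DecidableEq S] [TopologicalSpace S] [MeasurableSpace S]
  [MeasurableSingletonClass S] {R : S → S → ℝ} {Ω : Type*} [MeasurableSpace Ω]
  {P : S → Measure Ω} {A : ℝ≥0 → Ω → S}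

/-- The Markov property against a bounded functional of the past, for one state. -/
theorem IsMarkovChain.integral_mul_indicator (hA : IsMarkovChain R P A) (a b : S) (s h : ℝ≥0)
    {Z : Ω → ℝ} (hZ : Measurable[past A s] Z) {C : ℝ} (hC : ∀ ω, |Z ω| ≤ C) :
    ∫ ω, Z ω * {ω | A (s + h) ω = b}.indicator 1 ω ∂(P a)
      = ∫ ω, Z ω * transition P A h (A s ω) b ∂(P a) := by
  have := hA.isProbabilityMeasure a
  have hm := hA.past_le s
  have hset : MeasurableSet {ω | A (s + h) ω = b} :=
    hA.measurable (s + h) (measurableSet_singleton b)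
  have hind : Integrable ({ω | A (s + h) ω = b}.indicator (1 : Ω → ℝ)) (P a) :=
    (integrable_const (1 : ℝ)).indicator hset
  have htm : Measurable[past A s] fun ω => transition P A h (A s ω) b :=
    (measurable_of_finite fun c => transition P A h c b).comp (measurable_past A le_rfl)
  obtain ⟨K, -, hK⟩ := exists_bound fun c => transition P A h c b
  have hint : Integrable (fun ω => transition P A h (A s ω) b) (P a) :=
    integrable_of_bound (htm.mono hm le_rfl).aestronglyMeasurable fun ω => hK _
  -- The Markov property on events of the past says precisely that the transition probability is
  -- this conditional expectation; `Z` is then pulled out.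
  have hce : (fun ω => transition P A h (A s ω) b)
      =ᵐ[P a] (P a)[{ω | A (s + h) ω = b}.indicator (1 : Ω → ℝ) | past A s] := by
    refine ae_eq_condExp_of_forall_setIntegral_eq hm hind (fun E _ _ => hint.integrableOn)
      (fun E hE _ => ?_) htm.stronglyMeasurable.aestronglyMeasurable
    rw [setIntegral_indicator hset]
    simp only [Pi.one_apply, setIntegral_const, smul_eq_mul, mul_one]
    exact (hA.markov a b s h E hE).symm
  have hpull := condExp_stronglyMeasurable_mul_of_bound hm hZ.stronglyMeasurable hind C
    (Eventually.of_forall hC)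
  rw [← integral_condExp hm]
  refine integral_congr_ae ?_
  filter_upwards [hpull, hce] with ω h1 h2
  exact h1.trans (by rw [Pi.mul_apply, ← h2])

theorem IsMarkovChain.integral_mul_comp (hA : IsMarkovChain R P A) (a : S) (s h : ℝ≥0)
    {Z : Ω → ℝ} (hZ : Measurable[past A s] Z) {C : ℝ} (hC : ∀ ω, |Z ω| ≤ C) (φ : S → ℝ) :
    ∫ ω, Z ω * φ (A (s + h) ω) ∂(P a)
      = ∫ ω, Z ω * (transition P A h).mulVec φ (A s ω) ∂(P a) := by
  have := hA.isProbabilityMeasure a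
  have hZm : Measurable Z := hZ.mono (hA.past_le s) le_rfl
  have h1 : ∀ ω, Z ω * φ (A (s + h) ω)
      = ∑ b, (Z ω * {ω | A (s + h) ω = b}.indicator 1 ω) * φ b := fun ω => by
    simp only [mul_assoc, ← Finset.mul_sum]
    congr 1
    rw [Finset.sum_eq_single (A (s + h) ω)] <;> simp +contextual [eq_comm]
  have h2 : ∀ ω, Z ω * (transition P A h).mulVec φ (A s ω)
      = ∑ b, (Z ω * transition P A h (A s ω) b) * φ b := fun ω => by
    simp only [mul_assoc, ← Finset.mul_sum]
    rfl
  simp only [h1, h2]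
  rw [integral_finsetSum, integral_finsetSum]
  · refine Finset.sum_congr rfl fun b _ => ?_
    rw [integral_mul_const, integral_mul_const, hA.integral_mul_indicator a b s h hZ hC]
  · intro b _
    obtain ⟨K, hK0, hK⟩ := exists_bound fun c => transition P A h c b
    refine (integrable_of_bound (C := C * K) ((hZm.mul
      ((measurable_of_finite fun c => transition P A h c b).comp
        (hA.measurable s))).aestronglyMeasurable) fun ω => ?_).mul_const _
    refine (abs_mul _ _).trans_le ?_
    exact mul_le_mul (hC ω) (hK _) (abs_nonneg _) ((abs_nonneg _).trans (hC ω))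
  · intro b _
    refine (integrable_of_bound (C := C) ((hZm.mul (measurable_one.indicator
      (hA.measurable (s + h) (measurableSet_singleton b)))).aestronglyMeasurable)
        fun ω => ?_).mul_const _
    by_cases hb : A (s + h) ω = b
    · simpa [hb] using hC ω
    · simpa [hb] using (abs_nonneg _).trans (hC ω)

/-- The discrete Feynman–Kac formula along the grid of mesh `h`. -/
theorem IsMarkovChain.integral_prod_mul (hA : IsMarkovChain R P A) (a : S) (h : ℝ≥0)
    (d : S → ℝ) (m : ℕ) (φ : S → ℝ) :
    ∫ ω, (∏ i ∈ Finset.range m, d (A ((i + 1 : ℕ) * h) ω)) * φ (A (m * h) ω) ∂(P a)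
      = ((transition P A h * Matrix.diagonal d) ^ m).mulVec φ a := by
  have := hA.isProbabilityMeasure a
  induction m generalizing φ with
  | zero =>
    rw [integral_congr_ae (g := fun _ => φ a)]
    · simp
    · filter_upwards [hA.start a] with ω hω
      simp [hω]
  | succ m ih =>
    obtain ⟨K, hK0, hK⟩ := exists_bound d
    have hZ : Measurable[past A (m * h)]
        fun ω => ∏ i ∈ Finset.range m, d (A ((i + 1 : ℕ) * h) ω) := by
      refine Finset.measurable_fun_prod _ fun i hi =>
        (measurable_of_finite d).comp (measurable_past A ?_)
      gcongr
      exact Finset.mem_range.1 hi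
    have hC : ∀ ω, |∏ i ∈ Finset.range m, d (A ((i + 1 : ℕ) * h) ω)| ≤ K ^ m := fun ω => by
      rw [Finset.abs_prod]
      exact (Finset.prod_le_prod (fun i _ => abs_nonneg _) fun i _ => hK _).trans_eq (by simp)
    -- Conditioning on the past at time $mh$ integrates out the last step and replaces $\varphi$ by
    -- $P_hD\varphi$, where $D$ is the diagonal matrix of `d`. The weight sits at the right
    -- endpoint, hence $D$ acts before $P_h$.
    have hstep := hA.integral_mul_comp a (m * h) h hZ hC (fun b => d b * φ b)
    have hcast : ((m + 1 : ℕ) : ℝ≥0) * h = m * h + h := by push_cast; ring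
    simp only [Finset.prod_range_succ, mul_assoc, hcast]
    rw [hstep, ih, pow_succ, ← Matrix.mulVec_mulVec, ← Matrix.mulVec_mulVec]
    congr 2
    funext b
    rw [Matrix.mulVec_diagonal]

/-- The Riemann-sum functional `W m` has expectation $((P_{t/m}D_{t/m})^mf)(a)$. Dominated
convergence identifies the limit of the expectations, and `tendsto_pow_exp_of_tendsto` that of the
matrix powers. -/
theorem IsMarkovChain.feynmanKac [DiscreteTopology S] (hA : IsMarkovChain R P A) (f k : S → ℝ) (a : S) (t : ℝ≥0) :
    Integrable (fun ω => f (A t ω) * Real.exp (-∫ s in (0 : ℝ)..t, k (A s.toNNReal ω))) (P a) ∧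
    ∫ ω, f (A t ω) * Real.exp (-∫ s in (0 : ℝ)..t, k (A s.toNNReal ω)) ∂(P a)
      = NormedSpace.exp ((t : ℝ) • matrixCLM (Matrix.of R - Matrix.diagonal k)) f a := by
  have := hA.isProbabilityMeasure a
  have : Nonempty S := ⟨a⟩
  -- The mesh $t/m$ must be positive to approach $0$ within the range of the rate limit.
  rcases eq_or_ne t 0 with rfl | ht
  · have h0 : (fun ω => f (A 0 ω) * Real.exp (-∫ s in (0 : ℝ)..(0 : ℝ≥0), k (A s.toNNReal ω)))
        =ᵐ[P a] fun _ => f a := by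
      filter_upwards [hA.start a] with ω hω
      simp [hω]
    exact ⟨(integrable_congr h0).2 (integrable_const _), by rw [integral_congr_ae h0]; simp⟩
  obtain ⟨F, hF0, hF⟩ := exists_bound f
  obtain ⟨K, hK0, hK⟩ := exists_bound k
  let W : ℕ → Ω → ℝ := fun m ω => f (A t ω) *
    Real.exp (-∑ i ∈ Finset.range m, (t / m : ℝ≥0) * k (A ((i + 1 : ℕ) * (t / m)) ω))
  have hWm : ∀ m, Measurable (W m) := fun m => by
    refine ((measurable_of_finite f).comp (hA.measurable t)).mul
      (Real.measurable_exp.comp (Measurable.neg (Finset.measurable_fun_sum _ fun i _ =>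
        measurable_const.mul ((measurable_of_finite k).comp (hA.measurable _)))))
  have hWlim : ∀ᵐ ω ∂(P a), Tendsto (fun m => W m ω) atTop
      (𝓝 (f (A t ω) * Real.exp (-∫ s in (0 : ℝ)..t, k (A s.toNNReal ω)))) := by
    filter_upwards [hA.right_continuous a] with ω hω
    exact ((Real.continuous_exp.tendsto _).comp (tendsto_riemann_chain hω k t).neg).const_mul _
  have hWbd : ∀ m ω, ‖W m ω‖ ≤ F * Real.exp (t * K) := fun m ω => by
    rw [Real.norm_eq_abs, abs_mul, Real.abs_exp]
    refine mul_le_mul (hF _) (Real.exp_le_exp.2 ?_) (Real.exp_pos _).le hF0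
    rw [← Finset.sum_neg_distrib]
    calc ∑ i ∈ Finset.range m, -((t / m : ℝ≥0) * k (A ((i + 1 : ℕ) * (t / m)) ω))
        ≤ ∑ i ∈ Finset.range m, ((t / m : ℝ≥0) : ℝ) * K := by
          refine Finset.sum_le_sum fun i _ => ?_
          rw [← mul_neg]
          exact mul_le_mul_of_nonneg_left ((neg_le_abs _).trans (hK _)) (NNReal.coe_nonneg _)
      _ ≤ t * K := by
          rcases Nat.eq_zero_or_pos m with rfl | hm
          · simp; positivity
          · have : (m : ℝ) ≠ 0 := Nat.cast_ne_zero.2 hm.ne'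
            simp only [Finset.sum_const, Finset.card_range, nsmul_eq_mul]
            push_cast
            field_simp
            rfl
  -- Measurability of the path integral in $\omega$ is inherited from the Riemann sums.
  have hlimm := aestronglyMeasurable_of_tendsto_ae atTop
    (fun m => (hWm m).aestronglyMeasurable) hWlim
  refine ⟨Integrable.of_bound hlimm (F * Real.exp (t * K)) ?_, ?_⟩
  · filter_upwards [hWlim] with ω hω
    exact le_of_tendsto hω.norm (Eventually.of_forall fun m => hWbd m ω)
  have hDCT := tendsto_integral_of_dominated_convergence (fun _ => F * Real.exp (t * K))
    (fun m => (hWm m).aestronglyMeasurable) (integrable_const _)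
    (fun m => Eventually.of_forall (hWbd m)) hWlim
  refine tendsto_nhds_unique hDCT ?_
  have hmesh : Tendsto (fun m : ℕ => t / (m : ℝ≥0)) atTop (𝓝[>] 0) := by
    refine tendsto_nhdsWithin_iff.2 ⟨?_, ?_⟩
    · exact NNReal.tendsto_coe.1 (by simpa using tendsto_const_div_atTop_nhds_zero_nat (t : ℝ))
    · filter_upwards [eventually_gt_atTop 0] with m hm
      exact div_pos (pos_iff_ne_zero.2 ht) (Nat.cast_pos.2 hm)
  have hgen := (continuous_matrixCLM.tendsto _).comp
    (((hA.tendsto_transition k).comp hmesh).const_smul (t : ℝ))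
  rw [map_smul] at hgen
  have hpow := tendsto_pow_exp_of_tendsto (M := fun m : ℕ => matrixCLM (transition P A (t / m) *
    Matrix.diagonal fun b => Real.exp (-((t / m : ℝ≥0) * k b)))) (hgen.congr fun m => ?_)
  · have hev := tendsto_pi_nhds.1 (((ContinuousLinearMap.apply ℝ (S → ℝ) f).continuous.tendsto
      _).comp hpow) a
    refine hev.congr' ?_
    filter_upwards [eventually_gt_atTop 0] with m hm
    simp only [Function.comp_apply, ContinuousLinearMap.apply_apply, matrixCLM_pow_apply]
    rw [← hA.integral_prod_mul]
    refine integral_congr_ae (Eventually.of_forall fun ω => ?_)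
    have hmt : (m : ℝ≥0) * (t / m) = t := mul_div_cancel₀ _ (Nat.cast_ne_zero.2 hm.ne')
    simp only [W, hmt, ← Finset.sum_neg_distrib, Real.exp_sum]
    rw [mul_comm]
  · simp only [Function.comp_apply, map_smul, map_sub, matrixCLM_one, smul_smul]
    congr 1
    have : (t : ℝ) ≠ 0 := NNReal.coe_ne_zero.2 ht
    push_cast
    field_simp

end Chain

/-! ### Moments of the semigroup and of the diffusion -/

theorem abs_mon_le_one {V : Type*} [Fintype V] (a : V → ℕ) (x : stdSimplex ℝ V) : |mon a x.1| ≤ 1 := by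
  have h0 : ∀ i, 0 ≤ x.1 i := x.2.1
  have h1 : ∀ i, x.1 i ≤ 1 := fun i =>
    (Finset.single_le_sum (fun j _ => h0 j) (Finset.mem_univ i)).trans_eq x.2.2
  rw [mon, abs_of_nonneg (Finset.prod_nonneg fun i _ => pow_nonneg (h0 i) _)]
  exact Finset.prod_le_one (fun i _ => pow_nonneg (h0 i) _) fun i _ => pow_le_one₀ (h0 i) (h1 i)

section Moments

variable {V : Type*} [Fintype V] [DecidableEq V] {G : SimpleGraph V} [DecidableRel G.Adj]

/-- Evaluation at $x$ is a bounded functional on $C(\Delta)$, so it passes through the Banach-space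
integral and leaves the finite linear system for the moments. -/
theorem IsMarkovSemigroup.apply_monomial
    {T : ℝ≥0 → C(stdSimplex ℝ V, ℝ) →L[ℝ] C(stdSimplex ℝ V, ℝ)} (hT : IsMarkovSemigroup G T)
    {n : ℕ} (a : OrderedPartition V n) (x : stdSimplex ℝ V) (t : ℝ≥0) :
    T t (monomial a.1) x
      = NormedSpace.exp ((t : ℝ) • matrixCLM (killedRate G n)) (fun b => mon b.1 x.1) a := by
  have hcont : ∀ f, Continuous fun s : ℝ => T s.toNNReal f := fun f =>
    (hT.strongly_continuous f).comp continuous_real_toNNReal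
  have hy : Continuous fun (s : ℝ) (b : OrderedPartition V n) =>
      T s.toNNReal (monomial b.1) x := continuous_pi fun b =>
    (ContinuousEvalConst.continuous_eval_const x).comp (hcont _)
  have h := eq_exp_of_integral_eq (killedRate G n) hy (fun b => mon b.1 x.1) ?_ t.2
  · have ha := congrFun h a
    simpa using ha
  intro s hs b
  have hint := hT.integral_eq (mon b.1) (contDiff_mon _) s.toNNReal
  have hgen : generatorC G (mon b.1) (contDiff_mon _)
      = ∑ c, killedRate G n b c • (monomial c.1 : C(stdSimplex ℝ V, ℝ)) := by
    ext z
    simpa [Matrix.mulVec, dotProduct, ContinuousMap.sum_apply] using!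
      generator_mon_eq_mulVec G b z.1
  have hx := DFunLike.congr_fun hint x
  rw [Real.coe_toNNReal s hs] at hx
  refine hx.trans ?_
  have hev := (ContinuousMap.evalCLM ℝ x).intervalIntegral_comp_comm
    ((hcont (generatorC G (mon b.1) (contDiff_mon _))).intervalIntegrable 0 s) (μ := volume)
  refine hev.symm.trans (intervalIntegral.integral_congr fun r _ => ?_)
  simp only [hgen, map_sum, map_smul]
  simp [Matrix.mulVec, dotProduct]

/-- Fubini turns the vanishing expectations into the linear system. Continuity of every path, not
just almost every one, supplies the joint measurability in time and $\omega$. -/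
theorem integral_mon_eq_exp {Ω : Type*} [MeasurableSpace Ω] {μ : Measure Ω}
    [IsProbabilityMeasure μ] {n : ℕ} {x : stdSimplex ℝ V} {X : ℝ≥0 → Ω → stdSimplex ℝ V}
    (hX : ∀ t, Measurable (X t)) (hc : ∀ ω, Continuous fun t => X t ω)
    (hzero : ∀ (b : OrderedPartition V n) (t : ℝ≥0), ∫ ω, (mon b.1 (X t ω).1 - mon b.1 x.1
      - ∫ s in (0 : ℝ)..t, generator G (mon b.1) (X s.toNNReal ω).1) ∂μ = 0)
    (a : OrderedPartition V n) (t : ℝ≥0) :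
    ∫ ω, mon a.1 (X t ω).1 ∂μ
      = NormedSpace.exp ((t : ℝ) • matrixCLM (killedRate G n)) (fun b => mon b.1 x.1) a := by
  have hmonc : ∀ b : V → ℕ, Continuous (mon b) := fun b => (contDiff_mon b (m := 0)).continuous
  have hm : ∀ (b : V → ℕ) t, Measurable fun ω => mon b (X t ω).1 := fun b t =>
    (hmonc b).measurable.comp (measurable_subtype_coe.comp (hX t))
  have hmi : ∀ (b : V → ℕ) t, Integrable (fun ω => mon b (X t ω).1) μ := fun b t =>
    integrable_of_bound (hm b t).aestronglyMeasurable fun ω => abs_mon_le_one b _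
  have hpath : ∀ ω, Continuous fun s : ℝ => (X s.toNNReal ω).1 := fun ω =>
    continuous_subtype_val.comp ((hc ω).comp continuous_real_toNNReal)
  have hy : Continuous fun (s : ℝ) (b : OrderedPartition V n) =>
      ∫ ω, mon b.1 (X s.toNNReal ω).1 ∂μ := continuous_pi fun b =>
    continuous_of_dominated (bound := fun _ => 1) (fun s => (hm _ _).aestronglyMeasurable)
      (fun s => Eventually.of_forall fun ω => abs_mon_le_one _ _) (integrable_const _)
      (Eventually.of_forall fun ω => (hmonc _).comp (hpath ω))
  have h := eq_exp_of_integral_eq (killedRate G n) hy (fun b => mon b.1 x.1) ?_ t.2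
  · have ha := congrFun h a
    simpa using ha
  intro s hs b
  have hgc : Continuous (generator G (mon b.1)) := continuous_generator G (contDiff_mon _)
  have hjoint : Measurable (Function.uncurry fun (r : ℝ) ω =>
      generator G (mon b.1) (X r.toNNReal ω).1) :=
    measurable_uncurry_of_continuous_of_measurable (fun ω => hgc.comp (hpath ω))
      fun r => hgc.measurable.comp (measurable_subtype_coe.comp (hX _))
  obtain ⟨C, hC⟩ : ∃ C, ∀ z : stdSimplex ℝ V, |generator G (mon b.1) z.1| ≤ C := by
    refine ⟨‖generatorC G (mon b.1) (contDiff_mon _)‖, fun z => ?_⟩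
    exact (generatorC G (mon b.1) (contDiff_mon _)).norm_coe_le_norm z
  have hji : Integrable (Function.uncurry fun (r : ℝ) ω =>
      generator G (mon b.1) (X r.toNNReal ω).1) ((volume.restrict (Set.uIoc 0 s)).prod μ) := by
    rw [Set.uIoc_of_le hs]
    exact
      integrable_of_bound hjoint.aestronglyMeasurable fun p => hC _
  have hswap := intervalIntegral_integral_swap hji
  have hii : Integrable (fun ω => ∫ r in (0 : ℝ)..s,
      generator G (mon b.1) (X r.toNNReal ω).1) μ := by
    have := hji.integral_prod_right
    rw [Set.uIoc_of_le hs] at this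
    simpa only [intervalIntegral.integral_of_le hs, Function.uncurry_apply_pair] using this
  have hz := hzero b s.toNNReal
  rw [Real.coe_toNNReal s hs, integral_sub (f := fun ω => mon b.1 (X s.toNNReal ω).1 - mon b.1 x.1)
      ((hmi _ _).sub (integrable_const _)) hii,
    integral_sub (hmi _ _) (integrable_const _), ← hswap, sub_eq_zero] at hz
  simp only [integral_const, probReal_univ, one_smul] at hz
  rw [hz]
  refine intervalIntegral.integral_congr fun r _ => ?_
  simp only [generator_mon_eq_mulVec, Matrix.mulVec, dotProduct]
  rw [integral_finsetSum _ fun c _ => (hmi _ _).const_mul _]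
  exact Finset.sum_congr rfl fun c _ => integral_const_mul _ _

theorem IsDiffusion.integral_monomial {n : ℕ} {x : stdSimplex ℝ V} {Ω : Type*}
    {mΩ : MeasurableSpace Ω} {ℱ : Filtration ℝ≥0 mΩ} {Px : Measure Ω}
    {X : ℝ≥0 → Ω → stdSimplex ℝ V} (hX : IsDiffusion G x ℱ Px X)
    (a : OrderedPartition V n) (t : ℝ≥0) :
    ∫ ω, monomial a.1 (X t ω) ∂Px
      = NormedSpace.exp ((t : ℝ) • matrixCLM (killedRate G n)) (fun b => mon b.1 x.1) a := by
  have := hX.isProbabilityMeasure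
  classical
  -- The exceptional set is enlarged to a measurable null set on which the path is frozen at $x$.
  -- The modification `Y` may fail to be adapted, but only its expectations are used.
  let N := toMeasurable Px {ω | ¬ Continuous fun t => X t ω}
  have hN : Px N = 0 := (measure_toMeasurable _).trans (ae_iff.1 hX.continuous_paths)
  let Y : ℝ≥0 → Ω → stdSimplex ℝ V := fun t ω => if ω ∈ N then x else X t ω
  have hY : ∀ t, Measurable (Y t) := fun t =>
    Measurable.ite (measurableSet_toMeasurable _ _) measurable_const
      ((hX.adapted t).mono (ℱ.le t) le_rfl)
  have hYc : ∀ ω, Continuous fun t => Y t ω := fun ω => by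
    by_cases hω : ω ∈ N
    · simpa [Y, hω] using continuous_const
    · simpa [Y, hω] using not_not.1 fun h => hω (subset_toMeasurable _ _ h)
  have hXY : ∀ᵐ ω ∂Px, ∀ t, Y t ω = X t ω := by
    filter_upwards [measure_eq_zero_iff_ae_notMem.1 hN] with ω hω t
    simp [Y, hω]
  refine Eq.trans ?_ (integral_mon_eq_exp (μ := Px) (X := Y) hY hYc (fun b s => ?_) a t)
  · refine integral_congr_ae ?_
    filter_upwards [hXY] with ω hω
    rw [hω]
    rfl
  · have hM := hX.martingale (mon b.1) (contDiff_mon _)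
    -- A martingale has constant expectation, and this one is zero at time $0$.
    have h0 := hM.setIntegral_eq (zero_le : 0 ≤ s) MeasurableSet.univ
    simp only [setIntegral_univ, NNReal.coe_zero, intervalIntegral.integral_same, sub_self,
      integral_zero] at h0
    refine Eq.trans (integral_congr_ae ?_) h0.symm
    filter_upwards [hXY, hX.start] with ω hω hx
    simp only [hω, hx]

end Moments

end GraphDiffusion

end

theorem mainTheorem4 {V : Type*} [Fintype V] [DecidableEq V]
    (G : SimpleGraph V) [DecidableRel G.Adj] (hV : 2 ≤ Fintype.card V) (hG : G.Connected)
    -- the Markov semigroup associated with the generator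
    (T : ℝ≥0 → C(stdSimplex ℝ V, ℝ) →L[ℝ] C(stdSimplex ℝ V, ℝ))
    (hT : GraphDiffusion.IsMarkovSemigroup G T)
    -- the collision chain
    (n : ℕ) {Ω' : Type*} [MeasurableSpace Ω']
    (P : GraphDiffusion.OrderedPartition V n → Measure Ω')
    (A : ℝ≥0 → Ω' → GraphDiffusion.OrderedPartition V n)
    (hA : GraphDiffusion.IsMarkovChain (GraphDiffusion.rateMatrix G n) P A)
    (a : GraphDiffusion.OrderedPartition V n) (x : stdSimplex ℝ V) (t : ℝ≥0) :
    Integrable (GraphDiffusion.killedMonomial G A x t) (P a) ∧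
    T t (GraphDiffusion.monomial a.1) x
      = ∫ ω, GraphDiffusion.killedMonomial G A x t ω ∂(P a) ∧
    -- the diffusion started from `x`
    ∀ {Ω : Type*} {mΩ : MeasurableSpace Ω} (ℱ : Filtration ℝ≥0 mΩ) (Px : Measure Ω)
      (X : ℝ≥0 → Ω → stdSimplex ℝ V), GraphDiffusion.IsDiffusion G x ℱ Px X →
        T t (GraphDiffusion.monomial a.1) x
          = ∫ ω, GraphDiffusion.monomial a.1 (X t ω) ∂Px := by
  have hchain := hA.feynmanKac (fun b => GraphDiffusion.mon b.1 x.1)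
    (fun b => GraphDiffusion.killingRate G b.1) a t
  have hsemi := hT.apply_monomial a x t
  exact ⟨hchain.1, hsemi.trans hchain.2.symm,
    fun ℱ Px X hX => hsemi.trans (hX.integral_monomial a t).symm⟩
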